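/- Let $\mathcal N$ be a smooth $\mathfrak n$-dimensional manifold with a smooth symmetric $2$-covariant tensor $\gamma$, a smooth covector $\boldsymbol\ell$ and a smooth function $\ell^{(2)}$ forming metric hypersurface data, i.e. such that at every $p\in\mathcal N$ the symmetric bilinear form on $T_p\mathcal N\times\mathbb R$ $$\boldsymbol{\mathcal A}|_p\big((W,a),(Z,b)\big)=\gamma(W,Z)+a\,\boldsymbol\ell(Z)+b\,\boldsymbol\ell(W)+ab\,\ell^{(2)}$$ is non-degenerate. Let the symmetric $2$-contravariant tensor $P$, the vector field $n$ and the function $n^{(2)}$ be defined by splitting its inverse $\mathcal A$ on $T_p^\star\mathcal N\times\mathbb R$ as $$\mathcal A|_p\big((\boldsymbol\alpha,a),(\boldsymbol\beta,b)\big)=P(\boldsymbol\alpha,\boldsymbol\beta)+a\,\boldsymbol\beta(n)+b\,\boldsymbol\alpha(n)+ab\,n^{(2)},$$ and put $\mathbf F=\tfrac12 d\boldsymbol\ell$, $\boldsymbol s=\mathbf F(n,\cdot)$, $\mathbf U=\tfrac12\pounds_n\gamma+\tfrac12\big(\boldsymbol\ell\otimes dn^{(2)}+dn^{(2)}\otimes\boldsymbol\ell\big)$,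 where $d\boldsymbol\ell(X,Y)=X(\boldsymbol\ell(Y))-Y(\boldsymbol\ell(X))-\boldsymbol\ell([X,Y])$. Let $\overset{\circ}{\nabla}$ be the metric hypersurface connection, i.e. the unique torsion-free connection on $\mathcal N$ with $$(\overset{\circ}{\nabla}_X\gamma)(Z,W)=-\mathbf U(X,Z)\boldsymbol\ell(W)-\mathbf U(X,W)\boldsymbol\ell(Z),\qquad (\overset{\circ}{\nabla}_X\boldsymbol\ell)(Z)+(\overset{\circ}{\nabla}_Z\boldsymbol\ell)(X)=-2\ell^{(2)}\mathbf U(X,Z)$$ for all vector fields $X,Z,W$. Let $\overset{\circ}{\Sigma}=\pounds_n\overset{\circ}{\nabla}$ be the tensor $$\overset{\circ}{\Sigma}(X,W)=\pounds_n(\overset{\circ}{\nabla}_XW)-\overset{\circ}{\nabla}_X(\pounds_nW)-\overset{\circ}{\nabla}_{\pounds_nX}W .$$ Then, in abstract index notation (with $\overset{\circ}{\Sigma}{}^d{}_{ab}X^aW^b$ the components of $\overset{\circ}{\Sigma}(X,W)$, and with $2t_{(ab)}=t_{ab}+t_{ba}$), $$\overset{\circ}{\Sigma}{}^d{}_{ab}=n^d\Big(2\overset{\circ}{\nabla}_{(a}s_{b)}-n^{(2)}\overset{\circ}{\nabla}_a\overset{\circ}{\nabla}_b\ell^{(2)}-2\overset{\circ}{\nabla}_{(a}n^{(2)}\overset{\circ}{\nabla}_{b)}\ell^{(2)}+n(\ell^{(2)})\,U_{ab}\Big)$$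 $$\qquad+P^{dc}\Big(\overset{\circ}{\nabla}_aU_{bc}+\overset{\circ}{\nabla}_bU_{ca}-\overset{\circ}{\nabla}_cU_{ab}+\big(2s_c-n^{(2)}\overset{\circ}{\nabla}_c\ell^{(2)}\big)U_{ab}+2F_{c(a}\overset{\circ}{\nabla}_{b)}n^{(2)}\Big).$$ -/

import Mathlib

open scoped Manifold ContDiff
open Bundle

noncomputable section

namespace HypersurfaceData

variable {E : Type*} [NormedAddCommGroup E] [NormedSpace ℝ E] [FiniteDimensional ℝ E]
  {N : Type*} [TopologicalSpace N] [ChartedSpace E N]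

/-- The covariant symmetric tensor `𝑨|_p` on `T_pN × ℝ`, as a bilinear form:
`𝑨((W, a), (Z, b)) = γ(W, Z) + a ℓ(Z) + b ℓ(W) + a b ℓ⁽²⁾`. -/
def ambientForm (p : N)
    (γ : TangentSpace 𝓘(ℝ, E) p →L[ℝ] TangentSpace 𝓘(ℝ, E) p →L[ℝ] ℝ)
    (l : TangentSpace 𝓘(ℝ, E) p →L[ℝ] ℝ) (l2 : ℝ) :
    LinearMap.BilinForm ℝ (TangentSpace 𝓘(ℝ, E) p × ℝ) :=
  LinearMap.mk₂ ℝ (fun v w ↦ γ v.1 w.1 + v.2 * l w.1 + w.2 * l v.1 + v.2 * w.2 * l2)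
    (fun v v' w ↦ by simp; ring) (fun c v w ↦ by simp; ring)
    (fun v w w' ↦ by simp; ring) (fun c v w ↦ by simp; ring)

end HypersurfaceData

open HypersurfaceData in
/-- Metric hypersurface data `{N, γ, ℓ, ℓ⁽²⁾}` on a smooth manifold `N` modelled on `E`: smooth
tensor fields such that `𝑨|_p` is non-degenerate at every point. -/
structure MetricHypersurfaceData (E : Type*) [NormedAddCommGroup E] [NormedSpace ℝ E]
    [FiniteDimensional ℝ E] (N : Type*) [TopologicalSpace N] [ChartedSpace E N]
    [IsManifold 𝓘(ℝ, E) ∞ N] where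
  /-- the symmetric 2-covariant tensor `γ` -/
  γ : Π p : N, TangentSpace 𝓘(ℝ, E) p →L[ℝ] TangentSpace 𝓘(ℝ, E) p →L[ℝ] ℝ
  /-- the covector `ℓ` -/
  l : Π p : N, TangentSpace 𝓘(ℝ, E) p →L[ℝ] ℝ
  /-- the scalar `ℓ⁽²⁾` -/
  l2 : N → ℝ
  γ_smooth : ContMDiff 𝓘(ℝ, E) (𝓘(ℝ, E).prod 𝓘(ℝ, E →L[ℝ] E →L[ℝ] ℝ)) ∞
    (fun p ↦ TotalSpace.mk' (E →L[ℝ] E →L[ℝ] ℝ) p (γ p))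
  l_smooth : ContMDiff 𝓘(ℝ, E) (𝓘(ℝ, E).prod 𝓘(ℝ, E →L[ℝ] ℝ)) ∞
    (fun p ↦ TotalSpace.mk' (E →L[ℝ] ℝ) p (l p))
  l2_smooth : ContMDiff 𝓘(ℝ, E) 𝓘(ℝ, ℝ) ∞ l2
  γ_symm : ∀ p v w, γ p v w = γ p w v
  nondegenerate : ∀ p, (ambientForm p (γ p) (l p) (l2 p)).Nondegenerate

namespace HypersurfaceData

variable {E : Type*} [NormedAddCommGroup E] [NormedSpace ℝ E] [FiniteDimensional ℝ E]
  {N : Type*} [TopologicalSpace N] [ChartedSpace E N]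

section Calculus

variable [IsManifold 𝓘(ℝ, E) ∞ N]

variable (E N) in
/-- A (not necessarily smooth) vector field on `N`. -/
abbrev VField := Π p : N, TangentSpace 𝓘(ℝ, E) p

/-- `X ∈ Γ(TN)`. -/
def SmoothVField (X : VField E N) : Prop :=
  ContMDiff 𝓘(ℝ, E) (𝓘(ℝ, E).prod 𝓘(ℝ, E)) ∞ (fun p ↦ TotalSpace.mk' E p (X p))

/-- `α ∈ Γ(T*N)`. -/
def SmoothOneForm (α : Π p : N, TangentSpace 𝓘(ℝ, E) p →L[ℝ] ℝ) : Prop :=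
  ContMDiff 𝓘(ℝ, E) (𝓘(ℝ, E).prod 𝓘(ℝ, E →L[ℝ] ℝ)) ∞
    (fun p ↦ TotalSpace.mk' (E →L[ℝ] ℝ) p (α p))

/-- The derivative `X(f) = df(X)` of a function along a vector field. -/
def dir (X : VField E N) (f : N → ℝ) : N → ℝ :=
  fun p ↦ mvfderiv 𝓘(ℝ, E) f p (X p)

/-- The Lie bracket `[X, Y] = £_X Y`. -/
def bracket (X Y : VField E N) : VField E N := VectorField.mlieBracket 𝓘(ℝ, E) X Y

/-- `D_X Y` for an affine connection `D`. -/
def covD (D : CovariantDerivative 𝓘(ℝ, E) E (TangentSpace 𝓘(ℝ, E) : N → Type _))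
    (X Y : VField E N) : VField E N := fun p ↦ D Y p (X p)

/-- `(D_X θ)(Y) = X(θ(Y)) - θ(D_X Y)` for a one-form, given as an operator on vector fields. -/
def covD₁ (D : CovariantDerivative 𝓘(ℝ, E) E (TangentSpace 𝓘(ℝ, E) : N → Type _))
    (θ : VField E N → N → ℝ) (X Y : VField E N) : N → ℝ :=
  dir X (θ Y) - θ (covD D X Y)

/-- `(D_X T)(Y, Z) = X(T(Y, Z)) - T(D_X Y, Z) - T(Y, D_X Z)` for a 2-covariant tensor field, given
as an operator on vector fields. -/
def covD₂ (D : CovariantDerivative 𝓘(ℝ, E) E (TangentSpace 𝓘(ℝ, E) : N → Type _))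
    (T : VField E N → VField E N → N → ℝ) (X Y Z : VField E N) : N → ℝ :=
  dir X (T Y Z) - T (covD D X Y) Z - T Y (covD D X Z)

/-- `(£_V T)(X, Y) = V(T(X, Y)) - T([V, X], Y) - T(X, [V, Y])` for a 2-covariant tensor field. -/
def lieD₂ (V : VField E N) (T : VField E N → VField E N → N → ℝ) (X Y : VField E N) : N → ℝ :=
  dir V (T X Y) - T (bracket V X) Y - T X (bracket V Y)

/-- `(dθ)(X, Y) = X(θ(Y)) - Y(θ(X)) - θ([X, Y])` for a one-form. -/
def extD₁ (θ : VField E N → N → ℝ) (X Y : VField E N) : N → ℝ :=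
  dir X (θ Y) - dir Y (θ X) - θ (bracket X Y)

/-- The Lie derivative of a connection along `V`:
`(£_V D)(X, W) = £_V(D_X W) - D_X(£_V W) - D_{£_V X} W`. -/
def lieConnection (V : VField E N)
    (D : CovariantDerivative 𝓘(ℝ, E) E (TangentSpace 𝓘(ℝ, E) : N → Type _))
    (X W : VField E N) : VField E N :=
  bracket V (covD D X W) - covD D X (bracket V W) - covD D (bracket V X) W

end Calculus

end HypersurfaceData

namespace MetricHypersurfaceData

open HypersurfaceData

variable {E : Type*} [NormedAddCommGroup E] [NormedSpace ℝ E] [FiniteDimensional ℝ E]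
  {N : Type*} [TopologicalSpace N] [ChartedSpace E N] [IsManifold 𝓘(ℝ, E) ∞ N]
  (𝒟 : MetricHypersurfaceData E N)

instance (p : N) : FiniteDimensional ℝ (TangentSpace 𝓘(ℝ, E) p) :=
  inferInstanceAs (FiniteDimensional ℝ E)

/-- The isomorphism `(T_pN × ℝ)* ≅ T_pN × ℝ` inverse to `v ↦ 𝑨|_p(v, ·)`. -/
def sharp (p : N) : Module.Dual ℝ (TangentSpace 𝓘(ℝ, E) p × ℝ) ≃ₗ[ℝ] TangentSpace 𝓘(ℝ, E) p × ℝ :=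
  ((ambientForm p (𝒟.γ p) (𝒟.l p) (𝒟.l2 p)).toDual (𝒟.nondegenerate p)).symm

/-- The inverse contravariant tensor `𝓐|_p` on `T*_pN × ℝ`, where `(β, b)` is the functional
`(W, c) ↦ β(W) + b c`. -/
def inverseForm (p : N) (x y : (TangentSpace 𝓘(ℝ, E) p →L[ℝ] ℝ) × ℝ) : ℝ :=
  y.1 (𝒟.sharp p (x.1.toLinearMap.coprod (x.2 • LinearMap.id))).1
    + y.2 * (𝒟.sharp p (x.1.toLinearMap.coprod (x.2 • LinearMap.id))).2

/-- The tensor `P`, contracted on one slot with a one-form: the vector field `P(α, ·)`, which is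
characterised by `β(P(α, ·)) = 𝓐((α, 0), (β, 0))`. -/
def P (α : Π p : N, TangentSpace 𝓘(ℝ, E) p →L[ℝ] ℝ) : VField E N :=
  fun p ↦ (𝒟.sharp p ((α p).toLinearMap.coprod 0)).1

/-- The vector field `n`, which is characterised by `β(n) = 𝓐((0, 1), (β, 0))`. -/
def n : VField E N := fun p ↦ (𝒟.sharp p (LinearMap.coprod 0 LinearMap.id)).1

/-- The scalar `n⁽²⁾ = 𝓐((0, 1), (0, 1))`. -/
def n2 : N → ℝ := fun p ↦ 𝒟.inverseForm p (0, 1) (0, 1)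

theorem ambientForm_sharp (p : N) (f : Module.Dual ℝ (TangentSpace 𝓘(ℝ, E) p × ℝ))
    (w : TangentSpace 𝓘(ℝ, E) p × ℝ) :
    ambientForm p (𝒟.γ p) (𝒟.l p) (𝒟.l2 p) (𝒟.sharp p f) w = f w := by
  simp [sharp]

theorem sharp_symm (p : N) (f g : Module.Dual ℝ (TangentSpace 𝓘(ℝ, E) p × ℝ)) :
    f (𝒟.sharp p g) = g (𝒟.sharp p f) := by
  rw [← 𝒟.ambientForm_sharp p f, ← 𝒟.ambientForm_sharp p g]
  simp [ambientForm, 𝒟.γ_symm p (𝒟.sharp p f).1]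
  ring

/-- The splitting `𝓐((α, a), (β, b)) = P(α, β) + a n(β) + b n(α) + a b n⁽²⁾`. -/
theorem inverseForm_eq (p : N) (α β : Π p : N, TangentSpace 𝓘(ℝ, E) p →L[ℝ] ℝ) (a b : ℝ) :
    𝒟.inverseForm p (α p, a) (β p, b) =
      β p (𝒟.P α p) + a * β p (𝒟.n p) + b * α p (𝒟.n p) + a * b * 𝒟.n2 p := by
  have h : (α p).toLinearMap.coprod (a • LinearMap.id) =
      (α p).toLinearMap.coprod 0 + a • LinearMap.coprod 0 LinearMap.id := by
    ext <;> simp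
  have h2 := 𝒟.sharp_symm p (LinearMap.coprod 0 LinearMap.id) ((α p).toLinearMap.coprod 0)
  simp at h2
  simp only [inverseForm, h, map_add, map_smul, Prod.fst_add, Prod.snd_add, Prod.smul_fst,
    Prod.smul_snd]
  simp [inverseForm, n2, P, n, h2]
  ring

/-- `γ(X, Y)` -/
def γF (X Y : VField E N) : N → ℝ := fun p ↦ 𝒟.γ p (X p) (Y p)

/-- `ℓ(X)` -/
def lF (X : VField E N) : N → ℝ := fun p ↦ 𝒟.l p (X p)

/-- `F = (1/2) dℓ` -/
def F (X Y : VField E N) : N → ℝ := (1 / 2 : ℝ) • extD₁ 𝒟.lF X Y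

/-- `s = F(n, ·)` -/
def s (X : VField E N) : N → ℝ := 𝒟.F 𝒟.n X

/-- `U = (1/2) £_n γ + ℓ ⊗ₛ d n⁽²⁾` -/
def U (X Y : VField E N) : N → ℝ :=
  (1 / 2 : ℝ) • lieD₂ 𝒟.n 𝒟.γF X Y
    + (1 / 2 : ℝ) • (𝒟.lF X * dir Y 𝒟.n2 + 𝒟.lF Y * dir X 𝒟.n2)

/-- `D` is the metric hypersurface connection `∇°` of the data: the smooth torsion-free affine
connection with
`(D_X γ)(Z, W) = -U(X, Z) ℓ(W) - U(X, W) ℓ(Z)` and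
`(D_X ℓ)(Z) + (D_Z ℓ)(X) = -2 ℓ⁽²⁾ U(X, Z)`. -/
structure IsHypersurfaceConnection
    (D : CovariantDerivative 𝓘(ℝ, E) E (TangentSpace 𝓘(ℝ, E) : N → Type _)) : Prop where
  smooth : ContMDiffCovariantDerivativeOn E ∞ D.toFun Set.univ
  torsion_free : D.torsion = 0
  covD_γ : ∀ X Z W : VField E N, SmoothVField X → SmoothVField Z → SmoothVField W →
    covD₂ D 𝒟.γF X Z W = -(𝒟.U X Z * 𝒟.lF W) - 𝒟.U X W * 𝒟.lF Z
  covD_l : ∀ X Z : VField E N, SmoothVField X → SmoothVField Z →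
    covD₁ D 𝒟.lF X Z + covD₁ D 𝒟.lF Z X = -(2 * 𝒟.l2 * 𝒟.U X Z)

end MetricHypersurfaceData

end

set_option linter.unusedSectionVars false

/-! Write Σ for the Lie derivative of the connection along n, and S = Σ(X, Y). Inverting the ambient
form gives α(S) = γ(P(α), S) + α(n) ℓ(S) (`γ_P`), so it suffices to compute ℓ(S) and γ(S, W) for W =
P(α).

Both come from commuting £_n with ∇° on ℓ and on γ (`apply_lieConnection`, `apply_lieConnection₂`):
Σ measures this commutator. The defining equations of ∇° give ∇°γ and the symmetrised ∇°ℓ in terms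
of U, the definition of U gives £_nγ, and Cartan's formula gives £_nℓ. Since Σ is symmetric
(`lieConnection_comm`), a Koszul-type combination of three permuted γ-identities isolates γ(S, W),
and symmetrising the ℓ-identity isolates ℓ(S).

Both pieces contain £_nU and the Hessian of n⁽²⁾. These cancel because ℓ(P(α)) = -α(n) ℓ⁽²⁾. -/

namespace HypersurfaceData

variable {E : Type*} [NormedAddCommGroup E] [NormedSpace ℝ E]
  {N : Type*} [TopologicalSpace N] [ChartedSpace E N] [IsManifold 𝓘(ℝ, E) ∞ N]

/-! ### Calculus of smooth functions, vector fields and brackets. -/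

theorem SmoothVField.mdifferentiableAt {X : VField E N} (hX : SmoothVField X) (p : N) :
    MDiffAt (T% X) p :=
  (ContMDiff.contMDiffAt hX).mdifferentiableAt (by simp)

theorem isManifold_minSmoothness (k : ℕ∞) : IsManifold 𝓘(ℝ, E) (minSmoothness ℝ k) N := by
  rw [minSmoothness_of_isRCLikeNormedField]
  exact IsManifold.of_le (n := ∞) (mod_cast le_top)

theorem SmoothVField.bracket [CompleteSpace E] {X Y : VField E N} (hX : SmoothVField X)
    (hY : SmoothVField Y) : SmoothVField (bracket X Y) := by
  have : IsManifold 𝓘(ℝ, E) (minSmoothness ℝ 2) N := isManifold_minSmoothness 2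
  have : IsManifold 𝓘(ℝ, E) ((⊤ : ℕ∞) + 1) N := ‹IsManifold 𝓘(ℝ, E) ∞ N›
  exact ContDiff.mlieBracket_vectorField (m := ⊤) (n := ⊤) hX hY
    (by rw [minSmoothness_of_isRCLikeNormedField]; rfl)

theorem SmoothVField.covD {D : CovariantDerivative 𝓘(ℝ, E) E (TangentSpace 𝓘(ℝ, E) : N → Type _)}
    (hD : ContMDiffCovariantDerivativeOn E ∞ D.toFun Set.univ)
    {X Y : VField E N} (hX : SmoothVField X) (hY : SmoothVField Y) : SmoothVField (covD D X Y) := by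
  have h := hD.contMDiff (σ := Y) (ContMDiff.contMDiffOn hY)
  exact ContMDiff.clm_bundle_apply (contMDiffOn_univ.1 h) hX

theorem SmoothOneForm.apply {α : Π p : N, TangentSpace 𝓘(ℝ, E) p →L[ℝ] ℝ} (hα : SmoothOneForm α)
    {X : VField E N} (hX : SmoothVField X) :
    ContMDiff 𝓘(ℝ, E) 𝓘(ℝ, ℝ) ∞ (fun p ↦ α p (X p)) := by
  have h : ContMDiff 𝓘(ℝ, E) (𝓘(ℝ, E).prod 𝓘(ℝ)) ∞
      (fun p ↦ TotalSpace.mk' ℝ (E := Bundle.Trivial N ℝ) p (α p (X p))) :=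
    ContMDiff.clm_bundle_apply (E₂ := Bundle.Trivial N ℝ) hα hX
  intro p
  have := h p
  simp only [contMDiffAt_totalSpace] at this
  exact this.2

theorem contMDiff_dir {X : VField E N} (hX : SmoothVField X) {f : N → ℝ}
    (hf : ContMDiff 𝓘(ℝ, E) 𝓘(ℝ, ℝ) ∞ f) : ContMDiff 𝓘(ℝ, E) 𝓘(ℝ, ℝ) ∞ (dir X f) := by
  have h : ContMDiff 𝓘(ℝ, E) 𝓘(ℝ, ℝ).tangent ∞
      (fun p ↦ tangentMap 𝓘(ℝ, E) 𝓘(ℝ, ℝ) f ⟨p, X p⟩) :=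
    (hf.contMDiff_tangentMap (m := ∞) (by simp)).comp hX
  intro p
  refine ((contMDiffAt_totalSpace.1 (h p)).2).congr_of_eventuallyEq (.of_forall fun q ↦ ?_)
  simp [dir, mvfderiv, tangentMap]
  rfl

theorem contMDiff_fun_add {f g : N → ℝ} (hf : ContMDiff 𝓘(ℝ, E) 𝓘(ℝ, ℝ) ∞ f)
    (hg : ContMDiff 𝓘(ℝ, E) 𝓘(ℝ, ℝ) ∞ g) : ContMDiff 𝓘(ℝ, E) 𝓘(ℝ, ℝ) ∞ (f + g) := hf.add hg

theorem contMDiff_fun_sub {f g : N → ℝ} (hf : ContMDiff 𝓘(ℝ, E) 𝓘(ℝ, ℝ) ∞ f)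
    (hg : ContMDiff 𝓘(ℝ, E) 𝓘(ℝ, ℝ) ∞ g) : ContMDiff 𝓘(ℝ, E) 𝓘(ℝ, ℝ) ∞ (f - g) := hf.sub hg

theorem contMDiff_fun_neg {f : N → ℝ} (hf : ContMDiff 𝓘(ℝ, E) 𝓘(ℝ, ℝ) ∞ f) :
    ContMDiff 𝓘(ℝ, E) 𝓘(ℝ, ℝ) ∞ (-f) := hf.neg

theorem contMDiff_fun_mul {f g : N → ℝ} (hf : ContMDiff 𝓘(ℝ, E) 𝓘(ℝ, ℝ) ∞ f)
    (hg : ContMDiff 𝓘(ℝ, E) 𝓘(ℝ, ℝ) ∞ g) : ContMDiff 𝓘(ℝ, E) 𝓘(ℝ, ℝ) ∞ (f * g) := hf.mul hg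

theorem contMDiff_fun_const_smul {f : N → ℝ} (c : ℝ) (hf : ContMDiff 𝓘(ℝ, E) 𝓘(ℝ, ℝ) ∞ f) :
    ContMDiff 𝓘(ℝ, E) 𝓘(ℝ, ℝ) ∞ (c • f) := contMDiff_const.mul hf

theorem dir_add_right {X : VField E N} {f g : N → ℝ}
    (hf : ContMDiff 𝓘(ℝ, E) 𝓘(ℝ, ℝ) ∞ f) (hg : ContMDiff 𝓘(ℝ, E) 𝓘(ℝ, ℝ) ∞ g) :
    dir X (f + g) = dir X f + dir X g := by
  ext p
  simp [dir, mvfderiv_add ((hf p).mdifferentiableAt (by simp)) ((hg p).mdifferentiableAt (by simp))]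

theorem dir_neg_right {X : VField E N} {f : N → ℝ} : dir X (-f) = -dir X f := by
  ext p
  simp [dir, mvfderiv_neg]

theorem dir_sub_right {X : VField E N} {f g : N → ℝ}
    (hf : ContMDiff 𝓘(ℝ, E) 𝓘(ℝ, ℝ) ∞ f) (hg : ContMDiff 𝓘(ℝ, E) 𝓘(ℝ, ℝ) ∞ g) :
    dir X (f - g) = dir X f - dir X g := by
  ext p
  simp [dir, mvfderiv_sub ((hf p).mdifferentiableAt (by simp)) ((hg p).mdifferentiableAt (by simp))]

theorem dir_mul_right {X : VField E N} {f g : N → ℝ}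
    (hf : ContMDiff 𝓘(ℝ, E) 𝓘(ℝ, ℝ) ∞ f) (hg : ContMDiff 𝓘(ℝ, E) 𝓘(ℝ, ℝ) ∞ g) :
    dir X (f * g) = f * dir X g + g * dir X f := by
  ext p
  simp [dir, mvfderiv_mul ((hf p).mdifferentiableAt (by simp)) ((hg p).mdifferentiableAt (by simp))]

theorem dir_const_right {X : VField E N} (c : ℝ) : dir X (fun _ ↦ c) = 0 := by
  ext p
  simp [dir, mvfderiv_const]

theorem dir_const_smul_right {X : VField E N} {f : N → ℝ} (c : ℝ)
    (hf : ContMDiff 𝓘(ℝ, E) 𝓘(ℝ, ℝ) ∞ f) : dir X (c • f) = c • dir X f := by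
  have := dir_mul_right (X := X) (f := fun _ ↦ c) contMDiff_const hf
  rw [dir_const_right, mul_zero, add_zero] at this
  exact this

theorem dir_sub_left (X Y : VField E N) (f : N → ℝ) : dir (X - Y) f = dir X f - dir Y f := by
  ext p
  simp [dir]

theorem bracket_swap (X Y : VField E N) : bracket X Y = -bracket Y X :=
  VectorField.mlieBracket_swap

theorem bracket_add_right [CompleteSpace E] {X Y Z : VField E N} (hY : SmoothVField Y)
    (hZ : SmoothVField Z) : bracket X (Y + Z) = bracket X Y + bracket X Z := by
  ext p
  exact VectorField.mlieBracket_add_right (hY.mdifferentiableAt p) (hZ.mdifferentiableAt p)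

theorem bracket_neg_right [CompleteSpace E] {X Y : VField E N} (hY : SmoothVField Y) :
    bracket X (-Y) = -bracket X Y := by
  ext p
  have := VectorField.mlieBracket_const_smul_right (I := 𝓘(ℝ, E)) (V := X) (c := (-1 : ℝ))
    (hY.mdifferentiableAt p)
  simp only [neg_smul, one_smul] at this
  exact this

theorem bracket_sub_right [CompleteSpace E] {X Y Z : VField E N} (hY : SmoothVField Y)
    (hZ : SmoothVField Z) : bracket X (Y - Z) = bracket X Y - bracket X Z := by
  rw [sub_eq_add_neg, bracket_add_right hY (ContMDiff.neg_section hZ), bracket_neg_right hZ,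
    ← sub_eq_add_neg]

theorem bracket_jacobi [CompleteSpace E] {X Y Z : VField E N} (hX : SmoothVField X)
    (hY : SmoothVField Y) (hZ : SmoothVField Z) :
    bracket X (bracket Y Z) = bracket (bracket X Y) Z + bracket Y (bracket X Z) := by
  have : IsManifold 𝓘(ℝ, E) (minSmoothness ℝ 3) N := isManifold_minSmoothness 3
  have h2 : minSmoothness ℝ 2 ≤ (∞ : WithTop ℕ∞) := by
    rw [minSmoothness_of_isRCLikeNormedField]; exact ENat.LEInfty.out
  exact VectorField.leibniz_identity_mlieBracket (ContMDiff.of_le hX h2)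
    (ContMDiff.of_le hY h2) (ContMDiff.of_le hZ h2)

open VectorField in
-- The Leibniz rule applied twice. Smoothness of Z is asked only near p, so that Z may be a local
-- extension of a tangent vector.
theorem mlieBracket_mlieBracket_smul [CompleteSpace E] {X Y Z : VField E N} {p : N}
    (hY : SmoothVField Y) (hZ : ∀ᶠ q in nhds p, CMDiffAt ∞ (T% Z) q) {f : N → ℝ}
    (hf : ContMDiff 𝓘(ℝ, E) 𝓘(ℝ, ℝ) ∞ f) :
    mlieBracket 𝓘(ℝ, E) X (mlieBracket 𝓘(ℝ, E) Y (f • Z)) p =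
      dir X (dir Y f) p • Z p + dir Y f p • mlieBracket 𝓘(ℝ, E) X Z p
        + (dir X f p • mlieBracket 𝓘(ℝ, E) Y Z p
          + f p • mlieBracket 𝓘(ℝ, E) X (mlieBracket 𝓘(ℝ, E) Y Z) p) := by
  have : IsManifold 𝓘(ℝ, E) (minSmoothness ℝ 2) N := isManifold_minSmoothness 2
  have : IsManifold 𝓘(ℝ, E) ((⊤ : ℕ∞) + 1) N := ‹IsManifold 𝓘(ℝ, E) ∞ N›
  have hfp (q : N) : MDiffAt f q := (hf q).mdifferentiableAt (by simp)
  have hYf := (contMDiff_dir hY hf p).mdifferentiableAt (by simp)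
  have hZp := hZ.self_of_nhds.mdifferentiableAt (by simp)
  have hYZ : MDiffAt (T% (mlieBracket 𝓘(ℝ, E) Y Z)) p :=
    (ContMDiffAt.mlieBracket_vectorField (m := ⊤) (n := ⊤) (ContMDiff.contMDiffAt hY)
      hZ.self_of_nhds (by rw [minSmoothness_of_isRCLikeNormedField]; rfl)).mdifferentiableAt
      (by simp)
  have h1 : mlieBracket 𝓘(ℝ, E) Y (f • Z) =ᶠ[nhds p]
      dir Y f • Z + f • mlieBracket 𝓘(ℝ, E) Y Z := by
    filter_upwards [hZ] with q hq
    exact mlieBracket_smul_right (hfp q) (hq.mdifferentiableAt (by simp))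
  rw [show mlieBracket 𝓘(ℝ, E) X (mlieBracket 𝓘(ℝ, E) Y (f • Z)) p = _ from
      Filter.EventuallyEq.mlieBracket_vectorField_eq .rfl h1,
    mlieBracket_add_right (hYf.smul_section hZp) ((hfp p).smul_section hYZ),
    mlieBracket_smul_right hYf hZp, mlieBracket_smul_right (hfp p) hYZ]
  rfl

/-- The Lie bracket acts on functions as the commutator of derivations. -/
theorem dir_bracket [CompleteSpace E] {X Y : VField E N} (hX : SmoothVField X)
    (hY : SmoothVField Y) {f : N → ℝ} (hf : ContMDiff 𝓘(ℝ, E) 𝓘(ℝ, ℝ) ∞ f) :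
    dir (bracket X Y) f = dir X (dir Y f) - dir Y (dir X f) := by
  have : IsManifold 𝓘(ℝ, E) (minSmoothness ℝ 3) N := isManifold_minSmoothness 3
  have h2 : minSmoothness ℝ 2 ≤ (∞ : WithTop ℕ∞) := by
    rw [minSmoothness_of_isRCLikeNormedField]; exact ENat.LEInfty.out
  ext p
  -- The identity is read off as the coefficient of a nonzero vector at p, which exists only when E
  -- is nontrivial.
  rcases subsingleton_or_nontrivial E with hE | hE
  · have h0 (V : VField E N) (g : N → ℝ) : dir V g p = 0 := by
      have : V p = 0 := hE.elim (V p : E) 0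
      simp [dir, this]
    simp [h0]
  obtain ⟨v, hv⟩ := exists_ne (0 : E)
  let Z : VField E N := FiberBundle.extend E (show TangentSpace 𝓘(ℝ, E) p from v)
  have hZ : ∀ᶠ q in nhds p, CMDiffAt ∞ (T% Z) q := by
    obtain ⟨s, hs, hZs⟩ := FiberBundle.exists_contMDiffOn_extend (k := ∞) 𝓘(ℝ, E) E
      (V := (TangentSpace 𝓘(ℝ, E) : N → Type _)) (x₀ := p) v
    filter_upwards [eventually_mem_nhds_iff.2 hs] with q hq
    exact hZs.contMDiffAt hq
  have hZp : Z p = v := FiberBundle.extend_apply_self E (show TangentSpace 𝓘(ℝ, E) p from v)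
  have hZ' := hZ.self_of_nhds
  have hfZ : CMDiffAt ∞ (T% (f • Z)) p := (hf p).smul_section hZ'
  -- Compare the Jacobi identity for f • Z with f times the one for Z: the terms with one derivative
  -- on f and one bracket on Z cancel between the two sides, and only a multiple of Z p remains.
  have key := VectorField.leibniz_identity_mlieBracket_apply (x := p) (ContMDiffAt.of_le (hX p) h2)
    (ContMDiffAt.of_le (hY p) h2) (ContMDiffAt.of_le hfZ h2)
  have key' := VectorField.leibniz_identity_mlieBracket_apply (x := p) (ContMDiffAt.of_le (hX p) h2)
    (ContMDiffAt.of_le (hY p) h2) (ContMDiffAt.of_le hZ' h2)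
  rw [mlieBracket_mlieBracket_smul hY hZ hf, mlieBracket_mlieBracket_smul hX hZ hf,
    VectorField.mlieBracket_smul_right ((hf p).mdifferentiableAt (by simp))
      (hZ'.mdifferentiableAt (by simp)), key'] at key
  have h3 : (dir (bracket X Y) f p - (dir X (dir Y f) p - dir Y (dir X f) p)) • Z p = 0 := by
    change dir X (dir Y f) p • Z p + _ + _ = dir (bracket X Y) f p • Z p + _ + _ at key
    simp only [sub_smul]
    simp only [smul_add] at key
    refine Eq.trans ?_ (sub_eq_zero.2 key.symm)
    module
  rw [smul_eq_zero, hZp] at h3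
  exact sub_eq_zero.1 (h3.resolve_right hv)

theorem covD_sub_covD [FiniteDimensional ℝ E] [CompleteSpace E]
    {D : CovariantDerivative 𝓘(ℝ, E) E (TangentSpace 𝓘(ℝ, E) : N → Type _)}
    (hD : D.torsion = 0) {X Y : VField E N} (hX : SmoothVField X) (hY : SmoothVField Y) :
    covD D X Y - covD D Y X = bracket X Y := by
  ext p
  exact D.torsion_eq_zero_iff.1 hD (hX.mdifferentiableAt p) (hY.mdifferentiableAt p)

end HypersurfaceData

/-! ### Inversion of the ambient form: algebra and smoothness. -/

/-- Invertibility is an open condition and inversion of continuous linear maps is smooth, so near p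
the solution is the inverse of B applied to f. -/
theorem contMDiffAt_of_clm_apply_eq {E N : Type*} [NormedAddCommGroup E] [NormedSpace ℝ E]
    [TopologicalSpace N] [ChartedSpace E N] {V W : Type*} [NormedAddCommGroup V] [NormedSpace ℝ V]
    [CompleteSpace V] [NormedAddCommGroup W] [NormedSpace ℝ W] {k : WithTop ℕ∞} {B : N → V →L[ℝ] W}
    {v : N → V} {f : N → W} {p : N}
    (hB : ContMDiffAt 𝓘(ℝ, E) 𝓘(ℝ, V →L[ℝ] W) k B p) (hf : ContMDiffAt 𝓘(ℝ, E) 𝓘(ℝ, W) k f p)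
    (hinv : (B p).IsInvertible) (h : ∀ᶠ q in nhds p, B q (v q) = f q) :
    ContMDiffAt 𝓘(ℝ, E) 𝓘(ℝ, V) k v p := by
  have hBi : ContMDiffAt 𝓘(ℝ, E) 𝓘(ℝ, W →L[ℝ] V) k (fun q ↦ (B q).inverse) p :=
    ContDiffAt.comp_contMDiffAt (g := ContinuousLinearMap.inverse) (f := B)
      hinv.contDiffAt_map_inverse hB
  refine (hBi.clm_apply hf).congr_of_eventuallyEq ?_
  obtain ⟨e, he⟩ := hinv
  have hev : ∀ᶠ q in nhds p, ∃ e' : V ≃L[ℝ] W, (e' : V →L[ℝ] W) = B q :=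
    hB.continuousAt.eventually (he ▸ ContinuousLinearEquiv.nhds e)
  filter_upwards [h, hev] with q hq ⟨e', he'⟩
  rw [← hq, ← he', ContinuousLinearMap.inverse_equiv]
  simp

theorem ContinuousLinearMap.isInvertible_of_injective {V W : Type*} [NormedAddCommGroup V]
    [NormedSpace ℝ V] [FiniteDimensional ℝ V] [NormedAddCommGroup W] [NormedSpace ℝ W]
    [FiniteDimensional ℝ W] {B : V →L[ℝ] W} (hB : ∀ v, B v = 0 → v = 0)
    (h : Module.finrank ℝ V = Module.finrank ℝ W) : B.IsInvertible :=
  ⟨(LinearEquiv.ofInjectiveOfFinrankEq (B : V →ₗ[ℝ] W)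
    ((injective_iff_map_eq_zero (B : V →ₗ[ℝ] W)).2 hB) h).toContinuousLinearEquiv, by ext; rfl⟩

namespace MetricHypersurfaceData

open HypersurfaceData

variable {E : Type*} [NormedAddCommGroup E] [NormedSpace ℝ E] [FiniteDimensional ℝ E]
  {N : Type*} [TopologicalSpace N] [ChartedSpace E N] [IsManifold 𝓘(ℝ, E) ∞ N]
  (𝒟 : MetricHypersurfaceData E N)

theorem γ_n (p : N) (w : TangentSpace 𝓘(ℝ, E) p) :
    𝒟.γ p (𝒟.n p) w + 𝒟.n2 p * 𝒟.l p w = 0 := by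
  have := 𝒟.ambientForm_sharp p (LinearMap.coprod 0 LinearMap.id) (w, 0)
  simpa [ambientForm, n, n2, inverseForm] using this

theorem l_n (p : N) : 𝒟.l p (𝒟.n p) + 𝒟.n2 p * 𝒟.l2 p = 1 := by
  have := 𝒟.ambientForm_sharp p (LinearMap.coprod 0 LinearMap.id) (0, 1)
  simpa [ambientForm, n, n2, inverseForm] using this

theorem sharp_snd (p : N) (a : TangentSpace 𝓘(ℝ, E) p →L[ℝ] ℝ) :
    (𝒟.sharp p (a.toLinearMap.coprod 0)).2 = a (𝒟.n p) := by
  have := 𝒟.sharp_symm p (LinearMap.coprod 0 LinearMap.id) (a.toLinearMap.coprod 0)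
  simpa [n] using this

theorem γ_P (α : Π p : N, TangentSpace 𝓘(ℝ, E) p →L[ℝ] ℝ) (p : N) (w : TangentSpace 𝓘(ℝ, E) p) :
    𝒟.γ p (𝒟.P α p) w + α p (𝒟.n p) * 𝒟.l p w = α p w := by
  have := 𝒟.ambientForm_sharp p ((α p).toLinearMap.coprod 0) (w, 0)
  simpa [ambientForm, P, sharp_snd] using this

theorem l_P (α : Π p : N, TangentSpace 𝓘(ℝ, E) p →L[ℝ] ℝ) (p : N) :
    𝒟.l p (𝒟.P α p) + α p (𝒟.n p) * 𝒟.l2 p = 0 := by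
  have := 𝒟.ambientForm_sharp p ((α p).toLinearMap.coprod 0) (0, 1)
  simpa [ambientForm, P, sharp_snd] using this

omit [FiniteDimensional ℝ E] in
theorem _root_.HypersurfaceData.SmoothOneForm.inCoordinates
    {β : Π p : N, TangentSpace 𝓘(ℝ, E) p →L[ℝ] ℝ} (hβ : SmoothOneForm β) (p : N) :
    ∃ b : N → E →L[ℝ] ℝ, ContMDiffAt 𝓘(ℝ, E) 𝓘(ℝ, E →L[ℝ] ℝ) ∞ b p ∧
      ∀ q ∈ (trivializationAt E (TangentSpace 𝓘(ℝ, E)) p).baseSet, ∀ w,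
        b q w = β q ((trivializationAt E (TangentSpace 𝓘(ℝ, E)) p).symm q w) := by
  refine ⟨_, ((contMDiffAt_hom_bundle (E₂ := Bundle.Trivial N ℝ) _).1 (hβ p)).2, fun q hq w ↦ ?_⟩
  rw [ContinuousLinearMap.inCoordinates_eq hq (by simp)]
  simp

theorem γ_inCoordinates (p : N) :
    ∃ g : N → E →L[ℝ] E →L[ℝ] ℝ, ContMDiffAt 𝓘(ℝ, E) 𝓘(ℝ, E →L[ℝ] E →L[ℝ] ℝ) ∞ g p ∧
      ∀ q ∈ (trivializationAt E (TangentSpace 𝓘(ℝ, E)) p).baseSet, ∀ v w,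
        g q v w = 𝒟.γ q ((trivializationAt E (TangentSpace 𝓘(ℝ, E)) p).symm q v)
          ((trivializationAt E (TangentSpace 𝓘(ℝ, E)) p).symm q w) := by
  refine ⟨_, ((contMDiffAt_hom_bundle (F₂ := E →L[ℝ] ℝ)
    (E₂ := fun q : N ↦ TangentSpace 𝓘(ℝ, E) q →L[ℝ] Bundle.Trivial N ℝ q) _).1
      (𝒟.γ_smooth p)).2, fun q hq v w ↦ ?_⟩
  rw [inCoordinates_apply_eq₂ hq hq (by simp)]
  simp

/-- The hypotheses say that 𝑨((V, c), ·) = (β, b): in a trivialisation, a linear system with smooth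
coefficients that is invertible by non-degeneracy. The data (0, 1) give n and n⁽²⁾; the data (α, 0)
give P(α). -/
theorem smooth_of_ambient_eq {V : VField E N} {c b : N → ℝ}
    {β : Π p : N, TangentSpace 𝓘(ℝ, E) p →L[ℝ] ℝ} (hβ : SmoothOneForm β)
    (hb : ContMDiff 𝓘(ℝ, E) 𝓘(ℝ, ℝ) ∞ b)
    (h1 : ∀ p w, 𝒟.γ p (V p) w + c p * 𝒟.l p w = β p w)
    (h2 : ∀ p, 𝒟.l p (V p) + c p * 𝒟.l2 p = b p) :
    SmoothVField V ∧ ContMDiff 𝓘(ℝ, E) 𝓘(ℝ, ℝ) ∞ c := by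
  rw [SmoothVField, ContMDiff, ContMDiff, ← forall_and]
  intro p
  have hl : SmoothOneForm 𝒟.l := 𝒟.l_smooth
  obtain ⟨g, hg, hg'⟩ := 𝒟.γ_inCoordinates p
  obtain ⟨l, hlc, hl'⟩ := hl.inCoordinates p
  obtain ⟨β', hβc, hβ'⟩ := hβ.inCoordinates p
  set e := trivializationAt E (TangentSpace 𝓘(ℝ, E)) p with he
  have hp : p ∈ e.baseSet := mem_baseSet_trivializationAt E (TangentSpace 𝓘(ℝ, E)) p
  have hes (q : N) (hq : q ∈ e.baseSet) (w : TangentSpace 𝓘(ℝ, E) q) :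
      e.symm q (e ⟨q, w⟩).2 = w := e.symm_apply_apply_mk hq w
  let fst := ContinuousLinearMap.fst ℝ E ℝ
  let snd := ContinuousLinearMap.snd ℝ E ℝ
  -- `B q` is v ↦ 𝑨(v, ·) in the trivialisation, with the dual of E × ℝ split as E* × ℝ.
  let B : N → E × ℝ →L[ℝ] (E →L[ℝ] ℝ) × ℝ := fun q ↦
    (ContinuousLinearMap.inl ℝ (E →L[ℝ] ℝ) ℝ).comp
      ((g q).comp fst + ContinuousLinearMap.smulRightL ℝ (E × ℝ) (E →L[ℝ] ℝ) snd (l q)) +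
    (ContinuousLinearMap.inr ℝ (E →L[ℝ] ℝ) ℝ).comp ((l q).comp fst + 𝒟.l2 q • snd)
  have hBs : ContMDiffAt 𝓘(ℝ, E) 𝓘(ℝ, E × ℝ →L[ℝ] (E →L[ℝ] ℝ) × ℝ) ∞ B p :=
    (contMDiffAt_const.clm_comp ((hg.clm_comp contMDiffAt_const).add
      (contMDiffAt_const.clm_apply hlc))).add
      (contMDiffAt_const.clm_comp ((hlc.clm_comp contMDiffAt_const).add
      ((𝒟.l2_smooth p).smul contMDiffAt_const)))
  have hBv (q : N) (x : E) (t : ℝ) : B q (x, t) = (g q x + t • l q, l q x + 𝒟.l2 q * t) := by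
    simp [B, fst, snd]
  have hinv : (B p).IsInvertible := by
    refine ContinuousLinearMap.isInvertible_of_injective ?_ ?_
    · rintro ⟨x, t⟩ h
      rw [hBv, Prod.mk_eq_zero] at h
      have hA : ∀ w, ambientForm p (𝒟.γ p) (𝒟.l p) (𝒟.l2 p) (e.symm p x, t) w = 0 := by
        rintro ⟨w, s⟩
        have hw := congr($(h.1) (e ⟨p, w⟩).2)
        have hx := h.2
        simp [hg' p hp, hl' p hp, hes p hp w] at hw hx
        simp [ambientForm]
        linear_combination hw + s * hx
      obtain ⟨hx0, ht⟩ := Prod.mk_eq_zero.1 ((𝒟.nondegenerate p).1 _ hA)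
      have hx : x = 0 := by
        have hx1 := congr_arg Prod.snd (e.apply_mk_symm hp x)
        rw [hx0] at hx1
        exact hx1.symm.trans (e.linear ℝ hp).map_zero
      simp [hx, ht]
    · rw [Module.finrank_prod, Module.finrank_prod,
        ← (LinearMap.toContinuousLinearMap (𝕜 := ℝ) (E := E) (F' := ℝ)).finrank_eq,
        Subspace.dual_finrank_eq]
  have hv : ContMDiffAt 𝓘(ℝ, E) 𝓘(ℝ, E × ℝ) ∞ (fun q ↦ ((e ⟨q, V q⟩).2, c q)) p := by
    refine contMDiffAt_of_clm_apply_eq hBs (hβc.prodMk_space (hb p)) hinv ?_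
    filter_upwards [e.open_baseSet.mem_nhds hp] with q hq
    rw [hBv]
    ext w
    · simp [hg' q hq, hl' q hq, hβ' q hq, hes q hq, h1]
    · simp [hl' q hq, hes q hq, mul_comm, ← h2]
  exact ⟨contMDiffAt_totalSpace.2 ⟨contMDiffAt_id, 
    (ContinuousLinearMap.fst ℝ E ℝ).contMDiff.contMDiffAt.comp p hv⟩,
    (ContinuousLinearMap.snd ℝ E ℝ).contMDiff.contMDiffAt.comp p hv⟩

theorem contMDiff_n : SmoothVField 𝒟.n ∧ ContMDiff 𝓘(ℝ, E) 𝓘(ℝ, ℝ) ∞ 𝒟.n2 := by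
  refine 𝒟.smooth_of_ambient_eq (β := 0) (b := fun _ ↦ 1) ?_ contMDiff_const ?_ 𝒟.l_n
  · exact contMDiff_zeroSection ℝ (fun q : N ↦ TangentSpace 𝓘(ℝ, E) q →L[ℝ] Bundle.Trivial N ℝ q)
  · simpa using 𝒟.γ_n

theorem smoothVField_P {α : Π p : N, TangentSpace 𝓘(ℝ, E) p →L[ℝ] ℝ} (hα : SmoothOneForm α) :
    SmoothVField (𝒟.P α) :=
  (𝒟.smooth_of_ambient_eq (b := fun _ ↦ 0) hα contMDiff_const (𝒟.γ_P α) (𝒟.l_P α)).1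

end MetricHypersurfaceData

/-! ### Commuting a Lie derivative with a connection. -/

namespace HypersurfaceData

variable {E : Type*} [NormedAddCommGroup E] [NormedSpace ℝ E] [FiniteDimensional ℝ E]
  {N : Type*} [TopologicalSpace N] [ChartedSpace E N] [IsManifold 𝓘(ℝ, E) ∞ N]
  {D : CovariantDerivative 𝓘(ℝ, E) E (TangentSpace 𝓘(ℝ, E) : N → Type _)}

/-- The Lie derivative of a one-form, given as an operator on vector fields. -/
noncomputable def lieD₁ (V : VField E N) (θ : VField E N → N → ℝ) (X : VField E N) : N → ℝ :=
  dir V (θ X) - θ (bracket V X)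

/-- Take the bracket of V with D_X Y - D_Y X = [X, Y], expand the right side by Jacobi, and use
vanishing torsion again on each resulting bracket. -/
theorem lieConnection_comm (hDt : D.torsion = 0)
    (hDs : ContMDiffCovariantDerivativeOn E ∞ D.toFun Set.univ) {V X Y : VField E N}
    (hV : SmoothVField V) (hX : SmoothVField X) (hY : SmoothVField Y) :
    lieConnection V D X Y = lieConnection V D Y X := by
  have : CompleteSpace E := FiniteDimensional.complete ℝ E
  have h1 := covD_sub_covD hDt hX hY
  have h2 := covD_sub_covD hDt hX (hV.bracket hY)
  have h3 := covD_sub_covD hDt (hV.bracket hX) hY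
  have h4 := bracket_sub_right (X := V) (hX.covD hDs hY) (hY.covD hDs hX)
  rw [h1, bracket_jacobi hV hX hY, ← h2, ← h3] at h4
  rw [← sub_eq_zero]
  refine Eq.trans ?_ (sub_eq_zero.2 h4.symm)
  simp only [lieConnection]
  abel

/-- The commutator of a Lie and a covariant derivative of a one-form. -/
theorem apply_lieConnection (hDs : ContMDiffCovariantDerivativeOn E ∞ D.toFun Set.univ)
    {θ : VField E N → N → ℝ}
    (hθ : ∀ X, SmoothVField X → ContMDiff 𝓘(ℝ, E) 𝓘(ℝ, ℝ) ∞ (θ X))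
    (hsub : ∀ X Y, θ (X - Y) = θ X - θ Y)
    {V X Y : VField E N} (hV : SmoothVField V) (hX : SmoothVField X) (hY : SmoothVField Y) :
    θ (lieConnection V D X Y) = covD₁ D (lieD₁ V θ) X Y -
      (dir V (covD₁ D θ X Y) - covD₁ D θ (bracket V X) Y - covD₁ D θ X (bracket V Y)) := by
  have : CompleteSpace E := FiniteDimensional.complete ℝ E
  simp only [lieConnection, covD₁, lieD₁, hsub]
  rw [dir_sub_right (contMDiff_dir hV (hθ _ hY)) (hθ _ (hV.bracket hY)),
    dir_sub_right (contMDiff_dir hX (hθ _ hY)) (hθ _ (hX.covD hDs hY)),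
    dir_bracket hV hX (hθ _ hY)]
  ring

/-- The commutator of a Lie and a covariant derivative of a 2-covariant tensor. -/
theorem apply_lieConnection₂ (hDs : ContMDiffCovariantDerivativeOn E ∞ D.toFun Set.univ)
    {T : VField E N → VField E N → N → ℝ}
    (hT : ∀ X Y, SmoothVField X → SmoothVField Y → ContMDiff 𝓘(ℝ, E) 𝓘(ℝ, ℝ) ∞ (T X Y))
    (hsub : ∀ X Y Z, T (X - Y) Z = T X Z - T Y Z) (hsub' : ∀ X Y Z, T X (Y - Z) = T X Y - T X Z)
    {V X Y Z : VField E N} (hV : SmoothVField V) (hX : SmoothVField X) (hY : SmoothVField Y)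
    (hZ : SmoothVField Z) :
    T (lieConnection V D X Y) Z + T Y (lieConnection V D X Z) = covD₂ D (lieD₂ V T) X Y Z -
      (dir V (covD₂ D T X Y Z) - covD₂ D T (bracket V X) Y Z - covD₂ D T X (bracket V Y) Z
        - covD₂ D T X Y (bracket V Z)) := by
  have : CompleteSpace E := FiniteDimensional.complete ℝ E
  simp only [lieConnection, covD₂, lieD₂, hsub, hsub']
  have hVY := hV.bracket hY
  have hVZ := hV.bracket hZ
  have hXY := hX.covD hDs hY
  have hXZ := hX.covD hDs hZ
  rw [dir_sub_right (contMDiff_fun_sub (contMDiff_dir hV (hT _ _ hY hZ)) (hT _ _ hVY hZ)) (hT _ _ hY hVZ),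
    dir_sub_right (contMDiff_dir hV (hT _ _ hY hZ)) (hT _ _ hVY hZ),
    dir_sub_right (contMDiff_fun_sub (contMDiff_dir hX (hT _ _ hY hZ)) (hT _ _ hXY hZ)) (hT _ _ hY hXZ),
    dir_sub_right (contMDiff_dir hX (hT _ _ hY hZ)) (hT _ _ hXY hZ),
    dir_bracket hV hX (hT _ _ hY hZ)]
  ring

/-- The Hessian of a function with respect to a torsion-free connection is symmetric. -/
theorem covD₁_dir_comm (hDt : D.torsion = 0) {f : N → ℝ} (hf : ContMDiff 𝓘(ℝ, E) 𝓘(ℝ, ℝ) ∞ f)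
    {X Y : VField E N} (hX : SmoothVField X) (hY : SmoothVField Y) :
    covD₁ D (fun Z ↦ dir Z f) X Y = covD₁ D (fun Z ↦ dir Z f) Y X := by
  have : CompleteSpace E := FiniteDimensional.complete ℝ E
  have h := dir_bracket hX hY hf
  rw [← covD_sub_covD hDt hX hY, dir_sub_left] at h
  simp only [covD₁]
  linear_combination -h

theorem covD₂_comm {T : VField E N → VField E N → N → ℝ} (hT : ∀ X Y, T X Y = T Y X)
    (X Y Z : VField E N) : covD₂ D T X Y Z = covD₂ D T X Z Y := by
  simp only [covD₂, hT Z, hT (covD D X Z)]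
  ring

theorem lieD₂_comm {T : VField E N → VField E N → N → ℝ} (hT : ∀ X Y, T X Y = T Y X)
    (V X Y : VField E N) : lieD₂ V T X Y = lieD₂ V T Y X := by
  simp only [lieD₂, hT Y, hT (bracket V Y)]
  ring

end HypersurfaceData

/-! ### Lie and covariant derivatives of the hypersurface data. -/

namespace MetricHypersurfaceData

open HypersurfaceData

variable {E : Type*} [NormedAddCommGroup E] [NormedSpace ℝ E] [FiniteDimensional ℝ E]
  {N : Type*} [TopologicalSpace N] [ChartedSpace E N] [IsManifold 𝓘(ℝ, E) ∞ N]
  (𝒟 : MetricHypersurfaceData E N)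
  {D : CovariantDerivative 𝓘(ℝ, E) E (TangentSpace 𝓘(ℝ, E) : N → Type _)}

theorem contMDiff_lF {X : VField E N} (hX : SmoothVField X) :
    ContMDiff 𝓘(ℝ, E) 𝓘(ℝ, ℝ) ∞ (𝒟.lF X) :=
  SmoothOneForm.apply 𝒟.l_smooth hX

theorem contMDiff_γF {X Y : VField E N} (hX : SmoothVField X) (hY : SmoothVField Y) :
    ContMDiff 𝓘(ℝ, E) 𝓘(ℝ, ℝ) ∞ (𝒟.γF X Y) :=
  SmoothOneForm.apply (ContMDiff.clm_bundle_apply (F₂ := E →L[ℝ] ℝ)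
    (E₂ := fun q : N ↦ TangentSpace 𝓘(ℝ, E) q →L[ℝ] Bundle.Trivial N ℝ q) 𝒟.γ_smooth hX) hY

theorem lF_sub (X Y : VField E N) : 𝒟.lF (X - Y) = 𝒟.lF X - 𝒟.lF Y := by
  ext p; simp [lF]

theorem γF_sub_left (X Y Z : VField E N) : 𝒟.γF (X - Y) Z = 𝒟.γF X Z - 𝒟.γF Y Z := by
  ext p; simp [γF]

theorem γF_sub_right (X Y Z : VField E N) : 𝒟.γF X (Y - Z) = 𝒟.γF X Y - 𝒟.γF X Z := by
  ext p; simp [γF]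

theorem γF_comm (X Y : VField E N) : 𝒟.γF X Y = 𝒟.γF Y X := by
  ext p; exact 𝒟.γ_symm ..

theorem lF_n : 𝒟.lF 𝒟.n = (fun _ ↦ 1) - 𝒟.n2 * 𝒟.l2 := by
  ext p; exact eq_sub_of_add_eq (𝒟.l_n p)

theorem two_mul_F (X Y : VField E N) : 2 * 𝒟.F X Y = extD₁ 𝒟.lF X Y := by
  ext p; simp [F]

theorem F_swap (X Y : VField E N) : 𝒟.F X Y = -𝒟.F Y X := by
  have h : 𝒟.lF (bracket X Y) = -𝒟.lF (bracket Y X) := by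
    rw [bracket_swap]; ext p; simp [lF]
  ext p
  simp only [F, extD₁, h]
  simp
  ring

theorem two_mul_U (X Y : VField E N) :
    2 * 𝒟.U X Y = lieD₂ 𝒟.n 𝒟.γF X Y + (𝒟.lF X * dir Y 𝒟.n2 + 𝒟.lF Y * dir X 𝒟.n2) := by
  ext p; simp [U]; ring

theorem U_comm (X Y : VField E N) : 𝒟.U X Y = 𝒟.U Y X := by
  rw [U, U, lieD₂_comm 𝒟.γF_comm, add_comm (𝒟.lF X * _)]

theorem smoothVField_n : SmoothVField 𝒟.n := 𝒟.contMDiff_n.1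

theorem contMDiff_n2 : ContMDiff 𝓘(ℝ, E) 𝓘(ℝ, ℝ) ∞ 𝒟.n2 := 𝒟.contMDiff_n.2

theorem contMDiff_U {X Y : VField E N} (hX : SmoothVField X) (hY : SmoothVField Y) :
    ContMDiff 𝓘(ℝ, E) 𝓘(ℝ, ℝ) ∞ (𝒟.U X Y) := by
  have : CompleteSpace E := FiniteDimensional.complete ℝ E
  have hn := 𝒟.smoothVField_n
  exact contMDiff_fun_add
    (contMDiff_fun_const_smul _ (contMDiff_fun_sub (contMDiff_fun_sub
      (contMDiff_dir hn (𝒟.contMDiff_γF hX hY)) (𝒟.contMDiff_γF (hn.bracket hX) hY))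
      (𝒟.contMDiff_γF hX (hn.bracket hY))))
    (contMDiff_fun_const_smul _ (contMDiff_fun_add
      (contMDiff_fun_mul (𝒟.contMDiff_lF hX) (contMDiff_dir hY 𝒟.contMDiff_n2))
      (contMDiff_fun_mul (𝒟.contMDiff_lF hY) (contMDiff_dir hX 𝒟.contMDiff_n2))))

theorem contMDiff_s {X : VField E N} (hX : SmoothVField X) :
    ContMDiff 𝓘(ℝ, E) 𝓘(ℝ, ℝ) ∞ (𝒟.s X) := by
  have : CompleteSpace E := FiniteDimensional.complete ℝ E
  have hn := 𝒟.smoothVField_n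
  exact contMDiff_fun_const_smul _ (contMDiff_fun_sub (contMDiff_fun_sub
    (contMDiff_dir hn (𝒟.contMDiff_lF hX)) (contMDiff_dir hX (𝒟.contMDiff_lF hn)))
    (𝒟.contMDiff_lF (hn.bracket hX)))

/-- Cartan's formula £_nℓ = dℓ(n, ·) + d(ℓ(n)), with dℓ(n, ·) = 2s and ℓ(n) = 1 - n⁽²⁾ℓ⁽²⁾. -/
theorem lieD₁_n_lF (X : VField E N) :
    lieD₁ 𝒟.n 𝒟.lF X = 2 * 𝒟.s X - (𝒟.n2 * dir X 𝒟.l2 + 𝒟.l2 * dir X 𝒟.n2) := by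
  have h := 𝒟.two_mul_F 𝒟.n X
  rw [extD₁, lF_n, dir_sub_right contMDiff_const (𝒟.contMDiff_n2.mul 𝒟.l2_smooth),
    dir_const_right, dir_mul_right 𝒟.contMDiff_n2 𝒟.l2_smooth] at h
  rw [lieD₁, s]
  linear_combination -h

variable {𝒟}

/-- The symmetric part of ∇°ℓ is prescribed; the antisymmetric part is dℓ/2 because the torsion
vanishes. -/
theorem IsHypersurfaceConnection.covD₁_lF (hD : 𝒟.IsHypersurfaceConnection D) {X Y : VField E N}
    (hX : SmoothVField X) (hY : SmoothVField Y) :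
    covD₁ D 𝒟.lF X Y = 𝒟.F X Y - 𝒟.l2 * 𝒟.U X Y := by
  have h1 := hD.covD_l X Y hX hY
  have h2 := 𝒟.two_mul_F X Y
  rw [extD₁, ← covD_sub_covD hD.torsion_free hX hY, lF_sub] at h2
  ext p
  have h1 := congr_fun h1 p
  have h2 := congr_fun h2 p
  simp [covD₁] at h1 h2 ⊢
  linarith

theorem IsHypersurfaceConnection.γF_lieConnection (hD : 𝒟.IsHypersurfaceConnection D)
    {X Y Z : VField E N} (hX : SmoothVField X) (hY : SmoothVField Y) (hZ : SmoothVField Z) :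
    𝒟.γF (lieConnection 𝒟.n D X Y) Z + 𝒟.γF Y (lieConnection 𝒟.n D X Z) =
      2 * covD₂ D 𝒟.U X Y Z
      - (covD₁ D 𝒟.lF X Y * dir Z 𝒟.n2 + 𝒟.lF Y * covD₁ D (fun W ↦ dir W 𝒟.n2) X Z
        + covD₁ D 𝒟.lF X Z * dir Y 𝒟.n2 + 𝒟.lF Z * covD₁ D (fun W ↦ dir W 𝒟.n2) X Y)
      + lieD₂ 𝒟.n 𝒟.U X Y * 𝒟.lF Z + 𝒟.U X Y * lieD₁ 𝒟.n 𝒟.lF Z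
      + lieD₂ 𝒟.n 𝒟.U X Z * 𝒟.lF Y + 𝒟.U X Z * lieD₁ 𝒟.n 𝒟.lF Y := by
  have : CompleteSpace E := FiniteDimensional.complete ℝ E
  have hn := 𝒟.smoothVField_n
  have hm := 𝒟.contMDiff_n2
  -- The definition of U solved for £_nγ, as an equality of operators because the commutator formula
  -- differentiates £_nγ covariantly.
  have hlie : lieD₂ 𝒟.n 𝒟.γF = fun Y Z ↦
      (2 : ℝ) • 𝒟.U Y Z - (𝒟.lF Y * dir Z 𝒟.n2 + 𝒟.lF Z * dir Y 𝒟.n2) := by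
    funext Y Z
    refine eq_sub_of_add_eq ((𝒟.two_mul_U Y Z).symm.trans ?_)
    ext p; simp
  rw [apply_lieConnection₂ hD.smooth (fun _ _ ↦ 𝒟.contMDiff_γF) 𝒟.γF_sub_left 𝒟.γF_sub_right
    hn hX hY hZ, hlie, hD.covD_γ _ _ _ hX hY hZ, hD.covD_γ _ _ _ (hn.bracket hX) hY hZ,
    hD.covD_γ _ _ _ hX (hn.bracket hY) hZ, hD.covD_γ _ _ _ hX hY (hn.bracket hZ)]
  have hl {W} (hW : SmoothVField W) := 𝒟.contMDiff_lF hW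
  have hU {V W} (hV : SmoothVField V) (hW : SmoothVField W) := 𝒟.contMDiff_U hV hW
  have hd {W} (hW : SmoothVField W) := contMDiff_dir hW hm
  simp only [covD₂, covD₁, lieD₂, lieD₁]
  rw [dir_sub_right (contMDiff_fun_const_smul _ (hU hY hZ)) (contMDiff_fun_add
      (contMDiff_fun_mul (hl hY) (hd hZ)) (contMDiff_fun_mul (hl hZ) (hd hY))),
    dir_const_smul_right _ (hU hY hZ),
    dir_add_right (contMDiff_fun_mul (hl hY) (hd hZ)) (contMDiff_fun_mul (hl hZ) (hd hY)),
    dir_mul_right (hl hY) (hd hZ), dir_mul_right (hl hZ) (hd hY),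
    dir_sub_right (contMDiff_fun_neg (contMDiff_fun_mul (hU hX hY) (hl hZ)))
      (contMDiff_fun_mul (hU hX hZ) (hl hY)), dir_neg_right,
    dir_mul_right (hU hX hY) (hl hZ), dir_mul_right (hU hX hZ) (hl hY)]
  ext p
  simp
  ring

/-- Adding the commutator identity for ℓ to its copy with X and Y exchanged leaves only the
symmetrised ∇°ℓ, which is prescribed; thus no Lie derivative of F appears. Symmetry of Σ gives the
factor 2. -/
theorem IsHypersurfaceConnection.lF_lieConnection (hD : 𝒟.IsHypersurfaceConnection D)
    {X Y : VField E N} (hX : SmoothVField X) (hY : SmoothVField Y) :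
    2 * 𝒟.lF (lieConnection 𝒟.n D X Y) =
      covD₁ D (lieD₁ 𝒟.n 𝒟.lF) X Y + covD₁ D (lieD₁ 𝒟.n 𝒟.lF) Y X
        + 2 * (dir 𝒟.n 𝒟.l2 * 𝒟.U X Y + 𝒟.l2 * lieD₂ 𝒟.n 𝒟.U X Y) := by
  have : CompleteSpace E := FiniteDimensional.complete ℝ E
  have hn := 𝒟.smoothVField_n
  have hl {W} (hW : SmoothVField W) := 𝒟.contMDiff_lF hW
  have h1 := apply_lieConnection hD.smooth (fun _ ↦ 𝒟.contMDiff_lF) 𝒟.lF_sub hn hX hY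
  have h2 := apply_lieConnection hD.smooth (fun _ ↦ 𝒟.contMDiff_lF) 𝒟.lF_sub hn hY hX
  rw [lieConnection_comm hD.torsion_free hD.smooth hn hY hX] at h2
  have h3 := hD.covD_l _ _ (hn.bracket hX) hY
  have h4 := hD.covD_l _ _ hX (hn.bracket hY)
  have h5 := congr_arg (dir 𝒟.n) (hD.covD_l _ _ hX hY)
  rw [show 2 * 𝒟.l2 * 𝒟.U X Y = (2 : ℝ) • (𝒟.l2 * 𝒟.U X Y) by ext p; simp; ring, dir_neg_right,
    dir_const_smul_right _ (contMDiff_fun_mul 𝒟.l2_smooth (𝒟.contMDiff_U hX hY)),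
    dir_mul_right 𝒟.l2_smooth (𝒟.contMDiff_U hX hY),
    dir_add_right (f := covD₁ D 𝒟.lF X Y) (g := covD₁ D 𝒟.lF Y X)
      (contMDiff_fun_sub (contMDiff_dir hX (hl hY)) (hl (hX.covD hD.smooth hY)))
      (contMDiff_fun_sub (contMDiff_dir hY (hl hX)) (hl (hY.covD hD.smooth hX)))] at h5
  rw [lieD₂]
  ext p
  have h1 := congr_fun h1 p
  have h2 := congr_fun h2 p
  have h3 := congr_fun h3 p
  have h4 := congr_fun h4 p
  have h5 := congr_fun h5 p
  simp at h1 h2 h3 h4 h5 ⊢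
  linear_combination h1 + h2 + h3 + h4 - h5

theorem covD₁_lieD₁_n_lF {X Y : VField E N} (hY : SmoothVField Y) :
    covD₁ D (lieD₁ 𝒟.n 𝒟.lF) X Y = 2 * covD₁ D 𝒟.s X Y
      - (𝒟.n2 * covD₁ D (fun Z ↦ dir Z 𝒟.l2) X Y + 𝒟.l2 * covD₁ D (fun Z ↦ dir Z 𝒟.n2) X Y
        + dir X 𝒟.n2 * dir Y 𝒟.l2 + dir X 𝒟.l2 * dir Y 𝒟.n2) := by
  have hlie : lieD₁ 𝒟.n 𝒟.lF = fun Y ↦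
      (2 : ℝ) • 𝒟.s Y - (𝒟.n2 * dir Y 𝒟.l2 + 𝒟.l2 * dir Y 𝒟.n2) := by
    funext Y
    rw [lieD₁_n_lF]
    ext p; simp
  have hm := 𝒟.contMDiff_n2
  have hl2 := 𝒟.l2_smooth
  rw [hlie]
  simp only [covD₁]
  rw [dir_sub_right (contMDiff_fun_const_smul _ (𝒟.contMDiff_s hY)) (contMDiff_fun_add
      (contMDiff_fun_mul hm (contMDiff_dir hY hl2)) (contMDiff_fun_mul hl2 (contMDiff_dir hY hm))),
    dir_const_smul_right _ (𝒟.contMDiff_s hY),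
    dir_add_right (contMDiff_fun_mul hm (contMDiff_dir hY hl2))
      (contMDiff_fun_mul hl2 (contMDiff_dir hY hm)),
    dir_mul_right hm (contMDiff_dir hY hl2), dir_mul_right hl2 (contMDiff_dir hY hm)]
  ext p
  simp
  ring

end MetricHypersurfaceData

/-! ### Assembly of the formula. -/

open HypersurfaceData in
/-- The components of `Σ° = £_n ∇°` are contracted with arbitrary smooth vector fields `X` (index
`a`), `Y` (index `b`) and an arbitrary smooth one-form `α` (index `d`); then `P^{dc} α_d` is the
vector field `P(α, ·)`, which takes the place of the index `c`. -/
theorem lemma2p10 {E : Type*} [NormedAddCommGroup E] [NormedSpace ℝ E] [FiniteDimensional ℝ E]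
    {N : Type*} [TopologicalSpace N] [T2Space N] [SecondCountableTopology N] [ChartedSpace E N]
    [IsManifold 𝓘(ℝ, E) ∞ N]
    (𝒟 : MetricHypersurfaceData E N)
    (D : CovariantDerivative 𝓘(ℝ, E) E (TangentSpace 𝓘(ℝ, E) : N → Type _))
    (hD : 𝒟.IsHypersurfaceConnection D)
    (X Y : VField E N) (hX : SmoothVField X) (hY : SmoothVField Y)
    (α : Π p : N, TangentSpace 𝓘(ℝ, E) p →L[ℝ] ℝ) (hα : SmoothOneForm α) :
    (fun p ↦ α p (lieConnection 𝒟.n D X Y p)) =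
      (fun p ↦ α p (𝒟.n p)) *
        (covD₁ D 𝒟.s X Y + covD₁ D 𝒟.s Y X
          - 𝒟.n2 * covD₁ D (fun Z ↦ dir Z 𝒟.l2) X Y
          - (dir X 𝒟.n2 * dir Y 𝒟.l2 + dir Y 𝒟.n2 * dir X 𝒟.l2)
          + dir 𝒟.n 𝒟.l2 * 𝒟.U X Y)
      + (covD₂ D 𝒟.U X Y (𝒟.P α) + covD₂ D 𝒟.U Y (𝒟.P α) X - covD₂ D 𝒟.U (𝒟.P α) X Y
          + (2 * 𝒟.s (𝒟.P α) - 𝒟.n2 * dir (𝒟.P α) 𝒟.l2) * 𝒟.U X Y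
          + (𝒟.F (𝒟.P α) X * dir Y 𝒟.n2 + 𝒟.F (𝒟.P α) Y * dir X 𝒟.n2)) := by
  have : CompleteSpace E := FiniteDimensional.complete ℝ E
  have hP := 𝒟.smoothVField_P hα
  have hn := 𝒟.smoothVField_n
  set W := 𝒟.P α with hW
  set S := lieConnection 𝒟.n D X Y with hS
  have e1 := hD.γF_lieConnection hX hY hP
  have e2 := hD.γF_lieConnection hY hX hP
  have e3 := hD.γF_lieConnection hP hX hY
  have e4 := hD.lF_lieConnection hX hY
  -- The rewrites up to `ext p` use the symmetries of Σ, U and the Hessians and the antisymmetry of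
  -- F, so that the same quantities appear in all permuted identities.
  rw [lieConnection_comm hD.torsion_free hD.smooth hn hY hX, ← hS,
    covD₂_comm 𝒟.U_comm Y, 𝒟.U_comm Y X, lieD₂_comm 𝒟.U_comm _ Y X,
    covD₁_dir_comm hD.torsion_free 𝒟.contMDiff_n2 hY hX] at e2
  rw [lieConnection_comm hD.torsion_free hD.smooth hn hP hX,
    lieConnection_comm hD.torsion_free hD.smooth hn hP hY, 𝒟.γF_comm _ Y,
    𝒟.U_comm W X, 𝒟.U_comm W Y, lieD₂_comm 𝒟.U_comm _ W X, lieD₂_comm 𝒟.U_comm _ W Y,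
    covD₁_dir_comm hD.torsion_free 𝒟.contMDiff_n2 hP hX,
    covD₁_dir_comm hD.torsion_free 𝒟.contMDiff_n2 hP hY] at e3
  rw [← hS] at e1
  rw [𝒟.covD₁_lieD₁_n_lF hY, 𝒟.covD₁_lieD₁_n_lF hX,
    covD₁_dir_comm hD.torsion_free 𝒟.contMDiff_n2 hY hX,
    covD₁_dir_comm hD.torsion_free 𝒟.l2_smooth hY hX] at e4
  rw [hD.covD₁_lF hX hY, hD.covD₁_lF hX hP, 𝒟.lieD₁_n_lF, 𝒟.F_swap X W] at e1
  rw [hD.covD₁_lF hY hX, hD.covD₁_lF hY hP, 𝒟.lieD₁_n_lF, 𝒟.F_swap Y W, 𝒟.F_swap Y X,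
    𝒟.U_comm Y X] at e2
  rw [hD.covD₁_lF hP hX, hD.covD₁_lF hP hY, 𝒟.U_comm W X, 𝒟.U_comm W Y] at e3
  ext p
  have a1 := 𝒟.γ_P α p (S p)
  have a2 := 𝒟.l_P α p
  rw [𝒟.γ_symm, ← hW] at a1
  rw [← hW] at a2
  have e1 := congr_fun e1 p
  have e2 := congr_fun e2 p
  have e3 := congr_fun e3 p
  have e4 := congr_fun e4 p
  simp only [Pi.add_apply, Pi.sub_apply, Pi.mul_apply, Pi.neg_apply, Pi.ofNat_apply,
    MetricHypersurfaceData.lieD₁_n_lF] at e1 e2 e3 e4 ⊢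
  have b1 : 𝒟.γF S W p = 𝒟.γ p (S p) (W p) := rfl
  have b2 : 𝒟.lF S p = 𝒟.l p (S p) := rfl
  -- This value of ℓ(W) makes the £_nU and Hessian of n⁽²⁾ terms cancel against those in ℓ(S).
  have b3 : 𝒟.lF W p = -(α p (𝒟.n p) * 𝒟.l2 p) := eq_neg_of_add_eq_zero_left a2
  rw [b3] at e1 e2
  rw [b1] at e1 e2
  rw [← hS, b2] at e4
  -- In `e1 + e2 - e3` the terms γ(Y, Σ(X, W)) and γ(X, Σ(Y, W)) drop out, leaving 2γ(S, W); `e4`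
  -- gives 2ℓ(S), and `a1` combines the two into α(S).
  linear_combination -a1 + (e1 + e2 - e3) / 2 + α p (𝒟.n p) / 2 * e4
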